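/- Let $\Lambda$ and $\Gamma$ be countable discrete groups. A map $\phi:\Lambda\to\Gamma$ is called a uniform embedding if for every sequence of pairs $(\alpha_i,\beta_i)\in\Lambda\times\Lambda$, the sequence $\alpha_i^{-1}\beta_i$ eventually leaves every finite subset of $\Lambda$ if and only if $\phi(\alpha_i)^{-1}\phi(\beta_i)$ eventually leaves every finite subset of $\Gamma$; one says that $\Lambda$ embeds uniformly into $\Gamma$ if such a $\phi$ exists. For a commutative ring $R$ and a group $G$ let $$\mathrm{cd}_R(G)=\sup\{n\ge 0:\ H^n(G,M)\neq 0\text{ for some } RG\text{-module }M\},\qquad \mathrm{hd}_R(G)=\sup\{n\ge 0:\ H_n(G,M)\neq 0\text{ for some } RG\text{-module }M\},$$ both in $\mathbb{N}\cup\{\infty\}$ (with $\sup\emptyset=0$), be the cohomological and the homological dimension of $G$ over $R$. Theorem. Let $R$ be a commutative ring, and let $\Lambda$ and $\Gamma$ be countable discrete groups such that $\Lambda$ embeds uniformly into $\Gamma$. Then: (i) If $\mathrm{cd}_R(\Lambda)<\infty$, then $\mathrm{cd}_R(\Lambda)\le\mathrm{cd}_R(\Gamma)$. (ii) If $\Lambda$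 is amenable and $\mathbb{Q}\subset R$, then $\mathrm{cd}_R(\Lambda)\le\mathrm{cd}_R(\Gamma)$. (iii) If $\mathrm{hd}_R(\Lambda)<\infty$, then $\mathrm{hd}_R(\Lambda)\le\mathrm{hd}_R(\Gamma)$. (iv) If $\Lambda$ is amenable and $\mathbb{Q}\subset R$, then $\mathrm{hd}_R(\Lambda)\le\mathrm{hd}_R(\Gamma)$. -/

import Mathlib

open Filter
open scoped Pointwise

universe u v w

/-- A map `φ : Λ → Γ` of discrete groups is a uniform embedding if, for all sequences of pairs
`(aᵢ, bᵢ)` in `Λ × Λ`, the sequence `aᵢ⁻¹ bᵢ` eventually leaves every finite subset of `Λ` if and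
only if `φ(aᵢ)⁻¹ φ(bᵢ)` eventually leaves every finite subset of `Γ`. -/
def IsUniformGroupEmbedding {Λ : Type v} {Γ : Type w} [Group Λ] [Group Γ] (φ : Λ → Γ) : Prop :=
  ∀ a b : ℕ → Λ,
    Tendsto (fun i => (a i)⁻¹ * b i) atTop cofinite ↔
      Tendsto (fun i => (φ (a i))⁻¹ * φ (b i)) atTop cofinite

/-- `Λ` embeds uniformly into `Γ`. -/
def EmbedsUniformly (Λ : Type v) (Γ : Type w) [Group Λ] [Group Γ] : Prop :=
  ∃ φ : Λ → Γ, IsUniformGroupEmbedding φ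

/-- A discrete group is amenable if it carries a finitely additive, left-invariant probability
measure defined on all of its subsets. -/
def IsAmenableGroup (G : Type v) [Group G] : Prop :=
  ∃ m : Set G → ℝ,
    (∀ s, 0 ≤ m s) ∧ m Set.univ = 1 ∧
      (∀ s t, Disjoint s t → m (s ∪ t) = m s + m t) ∧
      ∀ (g : G) (s : Set G), m (g • s) = m s

/-- The cohomological dimension `cd_R(G) = sup {n | ∃ M, Hⁿ(G, M) ≠ 0}` in `ℕ ∪ {∞}`, where `M`
runs through the `R[G]`-modules, that is, the `R`-linear representations of `G`. -/
noncomputable def cohomologicalDimension (R G : Type u) [CommRing R] [Group G] : ℕ∞ :=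
  ⨆ (n : ℕ) (_ : ∃ M : Rep.{u} R G, Nontrivial (groupCohomology M n)), (n : ℕ∞)

/-- The homological dimension `hd_R(G) = sup {n | ∃ M, Hₙ(G, M) ≠ 0}` in `ℕ ∪ {∞}`, where `M`
runs through the `R[G]`-modules, that is, the `R`-linear representations of `G`. -/
noncomputable def homologicalDimension (R G : Type u) [CommRing R] [Group G] : ℕ∞ :=
  ⨆ (n : ℕ) (_ : ∃ M : Rep.{u} R G, Nontrivial (groupHomology M n)), (n : ℕ∞)

/-! Let `P` be the module of finitely valued functions on `Λ × Γ` supported near the graph of `φ`,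
with the commuting translation actions of `Λ` and `Γ`. The map `(x, y) ↦ φ(x)⁻¹y` to `Γ` and the map
`(x, y) ↦ ψ(y)⁻¹x` to `Λ`, with `φ(ψ(y))` nearest to `y`, are equivariant and take finitely many
values on each support. Cutting functions along their fibres (`LocalDecomposition`) makes `Hom(P,
M)` a retract of a coinduced module for either group, hence acyclic (`cocycleExact_linHom`). A
double complex then shows that, in positive degrees, `Hⁿ(Λ, Hom(P, M)^Γ)` vanishes if `Hⁿ(Γ, Hom(P,
M)^Λ)` does (`CocycleExactOn.of_commute`), so it vanishes above the dimension of `Γ`.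

To return to `M`, evaluate invariant measures on the indicator of the graph. A `Γ`-invariant measure
does not change when the mass of a function is moved along `Γ` onto the graph, so `evalGraph` is
`Λ`-equivariant; it is also onto. If `Λ` has finite dimension, the long exact sequence and
descending induction on the degree give vanishing for all `M`. If `Λ` is amenable and `ℚ ⊂ R`,
averaging fibre sums over `Λ` splits `evalGraph`, and finiteness is not needed.

Homology is dual: use `M`-valued functions and their `Γ`-coinvariants, into which `M` embeds by
`graphClass`. The functor `Hom(-, k⋆)`, with `k⋆` the character module, turns exactness of chains
into exactness of cochains, so the same double complex applies. -/

/-! ### Staircase argument in a double complex -/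

section Bicomplex

variable {C : ℕ → ℕ → Type*} [∀ p q, AddCommGroup (C p q)]
  (dh : ∀ p q, C p q →+ C (p + 1) q) (dv : ∀ p q, C p q →+ C p (q + 1))

/-- In a bicomplex in the first quadrant with exact rows and columns, the cohomology of the
horizontal kernels of the zeroth column controls the cohomology of the vertical kernels of the
zeroth row. -/
theorem bicomplex_exact_row_of_exact_column
    (dh_dh : ∀ p q c, dh (p + 1) q (dh p q c) = 0)
    (dv_dv : ∀ p q c, dv p (q + 1) (dv p q c) = 0)
    (dh_dv : ∀ p q c, dh p (q + 1) (dv p q c) = dv (p + 1) q (dh p q c))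
    (exact_h : ∀ p q c, dh (p + 1) q c = 0 → ∃ b, dh p q b = c)
    (exact_v : ∀ p q c, dv p (q + 1) c = 0 → ∃ b, dv p q b = c) (n : ℕ)
    (H : ∀ a : C 0 (n + 1), dh 0 (n + 1) a = 0 → dv 0 (n + 1) a = 0 →
      ∃ b : C 0 n, dh 0 n b = 0 ∧ dv 0 n b = a)
    (a : C (n + 1) 0) (hh : dh (n + 1) 0 a = 0) (hv : dv (n + 1) 0 a = 0) :
    ∃ b : C n 0, dv n 0 b = 0 ∧ dh n 0 b = a := by
  have step (p q : ℕ)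
      (X : ∀ a : C p (q + 1), dh p (q + 1) a = 0 → dv p (q + 1) a = 0 →
        ∃ b : C p q, dh p q b = 0 ∧ dv p q b = a)
      (a : C (p + 1) q) (hh : dh (p + 1) q a = 0) (hv : dv (p + 1) q a = 0) :
      ∃ b : C p q, dv p q b = 0 ∧ dh p q b = a := by
    obtain ⟨b, rfl⟩ := exact_h p q a hh
    obtain ⟨b', hb', e⟩ := X (dv p q b) (by rw [dh_dv, hv]) (dv_dv p q b)
    exact ⟨b - b', by rw [map_sub, e, sub_self], by rw [map_sub, hb', sub_zero]⟩
  -- Walk along the antidiagonal `p + q = n`, from the zeroth column to the zeroth row.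
  have key (p : ℕ) : ∀ q, p + q = n → ∀ a : C (p + 1) q, dh (p + 1) q a = 0 →
      dv (p + 1) q a = 0 → ∃ b : C p q, dv p q b = 0 ∧ dh p q b = a := by
    induction p with
    | zero =>
      intro q hq
      obtain rfl : q = n := by omega
      exact step 0 q H
    | succ p ih =>
      intro q hq
      refine step (p + 1) q fun a hh hv => ?_
      obtain ⟨b, hb, rfl⟩ := ih (q + 1) (by omega) a hh hv
      obtain ⟨c, rfl⟩ := exact_v p q b hb
      exact ⟨dh p q c, dh_dh p q c, (dh_dv p q c).symm⟩
  exact key n 0 rfl a hh hv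

end Bicomplex

/-! ### Inhomogeneous cochains of two commuting actions -/

namespace Representation

section Cochains

variable {k G K V : Type u} [CommRing k] [Group G] [Group K] [AddCommGroup V] [Module k V]

/-- The differential on inhomogeneous cochains of a representation. -/
def cochainDiff (ρ : Representation k G V) (n : ℕ) :
    ((Fin n → G) → V) →ₗ[k] ((Fin (n + 1) → G) → V) :=
  (inhomogeneousCochains.d (Rep.of ρ) n).hom

theorem cochainDiff_apply (ρ : Representation k G V) (n : ℕ) (f : (Fin n → G) → V)
    (g : Fin (n + 1) → G) :
    cochainDiff ρ n f g = ρ (g 0) (f fun i => g i.succ) +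
      ∑ j : Fin (n + 1), (-1 : k) ^ ((j : ℕ) + 1) • f (Fin.contractNth j (· * ·) g) := rfl

theorem cochainDiff_cochainDiff (ρ : Representation k G V) (n : ℕ) (f : (Fin n → G) → V) :
    cochainDiff ρ (n + 1) (cochainDiff ρ n f) = 0 := by
  have := congr(($(groupCohomology.inhomogeneousCochains.d_comp_d n (Rep.of ρ))).hom f)
  exact this

theorem cochainDiff_zero_eq_zero_iff (ρ : Representation k G V) (f : (Fin 0 → G) → V) :
    cochainDiff ρ 0 f = 0 ↔ ∀ g, ρ g (f default) = f default := by
  constructor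
  · intro h g
    have := congrFun h (fun _ => g)
    rw [cochainDiff_apply, Fin.sum_univ_succ] at this
    rw [Subsingleton.elim (fun i : Fin 0 => g) default,
      Subsingleton.elim (Fin.contractNth _ _ _) default] at this
    simpa [add_neg_eq_zero] using this
  · intro h
    funext g
    rw [cochainDiff_apply, Fin.sum_univ_succ]
    rw [Subsingleton.elim (fun i : Fin 0 => g i.succ) default,
      Subsingleton.elim (Fin.contractNth _ _ _) default]
    simp [h]

/-- Every inhomogeneous `(n+1)`-cocycle is a coboundary. -/
def CocycleExact (ρ : Representation k G V) (n : ℕ) : Prop :=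
  ∀ c, cochainDiff ρ (n + 1) c = 0 → ∃ b, cochainDiff ρ n b = c

/-- Every inhomogeneous `(n+1)`-cocycle of `ρ` with values in the `σ`-invariants is the coboundary
of a cochain with values in the `σ`-invariants. -/
def CocycleExactOn (σ : Representation k K V) (ρ : Representation k G V) (n : ℕ) : Prop :=
  ∀ c, (∀ h g, σ h (c g) = c g) → cochainDiff ρ (n + 1) c = 0 →
    ∃ b, (∀ h g, σ h (b g) = b g) ∧ cochainDiff ρ n b = c

/-- Cochains in both groups form a double complex, exact in positive degrees by acyclicity of `ρ`
and `σ`. The kernels along its two edges are the cochains with values in the invariants of the other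
group. -/
theorem CocycleExactOn.of_commute {ρ : Representation k G V} {σ : Representation k K V}
    (comm : ∀ g h v, ρ g (σ h v) = σ h (ρ g v)) (hρ : ∀ n, CocycleExact ρ n)
    (hσ : ∀ n, CocycleExact σ n) {n : ℕ} (H : CocycleExactOn ρ σ n) : CocycleExactOn σ ρ n := by
  let dh (p q : ℕ) : ((Fin p → G) → (Fin q → K) → V) →+ ((Fin (p + 1) → G) → (Fin q → K) → V) :=
    { toFun := fun c x y => cochainDiff ρ p (fun x => c x y) x
      map_zero' := by ext x y; exact congrFun (map_zero (cochainDiff ρ p)) x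
      map_add' := fun a b => by
        ext x y; exact congrFun (map_add (cochainDiff ρ p) (fun x => a x y) fun x => b x y) x }
  let dv (p q : ℕ) : ((Fin p → G) → (Fin q → K) → V) →+ ((Fin p → G) → (Fin (q + 1) → K) → V) :=
    { toFun := fun c x => cochainDiff σ q (c x)
      map_zero' := by ext x y; exact congrFun (map_zero (cochainDiff σ q)) y
      map_add' := fun a b => by ext x y; exact congrFun (map_add (cochainDiff σ q) (a x) (b x)) y }
  have dh_apply (p q c x y) : dh p q c x y = cochainDiff ρ p (fun x => c x y) x := rfl
  have dv_apply (p q c x) : dv p q c x = cochainDiff σ q (c x) := rfl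
  have key := bicomplex_exact_row_of_exact_column dh dv
    (fun p q c => by
      ext x y; exact congrFun (cochainDiff_cochainDiff ρ p fun x => c x y) x)
    (fun p q c => by ext x y; exact congrFun (cochainDiff_cochainDiff σ q (c x)) y)
    (fun p q c => by
      ext x y
      rw [dh_apply, dv_apply]
      simp only [dv_apply, dh_apply, cochainDiff_apply, map_add, map_sum, map_smul, smul_add,
        Finset.smul_sum, Finset.sum_add_distrib, comm]
      rw [Finset.sum_comm, add_add_add_comm, add_add_add_comm]
      simp only [smul_smul, mul_comm]
      abel)
    (fun p q c h => by
      choose b hb using fun y => hρ p (fun x => c x y) (by ext x; exact congrFun (congrFun h x) y)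
      exact ⟨fun x y => b y x, by ext x y; exact congrFun (hb y) x⟩)
    (fun p q c h => by
      choose b hb using fun x => hσ q (c x) (by ext y; exact congrFun (congrFun h x) y)
      exact ⟨b, by ext x y; exact congrFun (hb x) y⟩) n
    (fun a h₁ h₂ => by
      obtain ⟨b, hb, hb'⟩ := H (a default)
        (fun g y => (cochainDiff_zero_eq_zero_iff ρ fun x => a x y).1
          (by ext x; exact congrFun (congrFun h₁ x) y) g) (congrFun h₂ default)
      refine ⟨fun _ => b, ?_, ?_⟩
      · ext x y
        exact congrFun ((cochainDiff_zero_eq_zero_iff ρ fun _ => b y).2 fun g => hb g y) x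
      · ext x y
        rw [Subsingleton.elim x default]
        exact congrFun hb' y)
  intro c hc hc'
  obtain ⟨b, hb, hb'⟩ := key (fun x _ => c x)
    (by ext x y; exact congrFun hc' x)
    (by
      ext x y
      exact congrFun ((cochainDiff_zero_eq_zero_iff σ fun _ => c x).2 fun h => hc h x) y)
  refine ⟨fun x => b x default, fun h g =>
    (cochainDiff_zero_eq_zero_iff σ (b g)).1 (congrFun hb g) h, ?_⟩
  ext x
  exact congrFun (congrFun hb' x) default

end Cochains

/-! ### Acyclicity from local decompositions -/

section Decomposition

variable {k G P T : Type u} [CommRing k] [Group G] [AddCommGroup P] [Module k P] [AddCommGroup T]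
  [Module k T]

/-- An equivariant, pointwise finite way of writing the elements `x` of a representation as
`x = ∑ g, g⁻¹ • parts x g`. -/
structure LocalDecomposition (ρ : Representation k G P) where
  parts : P →ₗ[k] (G →₀ P)
  parts_smul : ∀ g x h, parts (ρ g x) h = parts x (h * g)
  sum_parts : ∀ x, ((parts x).sum fun g y => ρ g⁻¹ y) = x

namespace LocalDecomposition

variable {ρ : Representation k G P} (D : LocalDecomposition ρ) (τ : Representation k G T)

/-- The equivariant retraction of a coinduced module onto `Hom(P, T)` given by a decomposition. -/
noncomputable def retraction : (G → P →ₗ[k] T) →ₗ[k] P →ₗ[k] T where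
  toFun w := Finsupp.lsum k (fun g => τ g⁻¹ ∘ₗ w g) ∘ₗ D.parts
  map_add' a b := by
    ext x
    exact (Finsupp.sum_congr fun g _ => map_add (τ g⁻¹) _ _).trans Finsupp.sum_add
  map_smul' r a := by
    ext x
    exact (Finsupp.sum_congr fun g _ => map_smul (τ g⁻¹) _ _).trans Finsupp.smul_sum.symm

theorem retraction_apply (w : G → P →ₗ[k] T) (x : P) :
    D.retraction τ w x = (D.parts x).sum fun g y => τ g⁻¹ (w g y) := rfl

theorem retraction_smul (w : G → P →ₗ[k] T) (g : G) :
    D.retraction τ (fun z => w (z * g)) = linHom ρ τ g (D.retraction τ w) := by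
  ext x
  have : D.parts (ρ g⁻¹ x) = (D.parts x).mapDomain (· * g) := by
    ext h
    rw [D.parts_smul, ← Equiv.coe_mulRight, ← Finsupp.equivMapDomain_eq_mapDomain]
    simp [Finsupp.equivMapDomain_apply]
  rw [linHom_apply, LinearMap.comp_apply, LinearMap.comp_apply, retraction_apply,
    retraction_apply, this, Finsupp.sum_mapDomain_index (by simp) (by simp), map_finsuppSum]
  simp [mul_inv_rev]

theorem retraction_orbit (v : P →ₗ[k] T) :
    D.retraction τ (fun z => linHom ρ τ z v) = v := by
  ext x
  rw [retraction_apply]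
  conv_rhs => rw [← D.sum_parts x, map_finsuppSum]
  simp

/-- Coinduced modules are contracted by reading a new first variable `z` of a cocycle as the
coinduced coordinate. Applying `retraction` to the cocycle identity at `(z, x)` carries this to
`Hom(P, T)`: the orbit term returns `c x` and the others form a coboundary. -/
theorem cocycleExact_linHom {ρ : Representation k G P} (D : LocalDecomposition ρ)
    (τ : Representation k G T) (n : ℕ) : CocycleExact (linHom ρ τ) n := by
  intro c hc
  refine ⟨fun x => D.retraction τ fun z => c (Fin.cons z x), ?_⟩
  funext x
  have h : D.retraction τ (fun z => cochainDiff (linHom ρ τ) (n + 1) c (Fin.cons z x)) = 0 := by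
    rw [hc]; exact map_zero _
  have e : (fun z => cochainDiff (linHom ρ τ) (n + 1) c (Fin.cons z x)) =
      (fun z => linHom ρ τ z (c x)) - (fun z => c (Fin.cons (z * x 0) fun i => x i.succ)) -
      ∑ j : Fin (n + 1), (-1 : k) ^ ((j : ℕ) + 1) •
        fun z => c (Fin.cons z (Fin.contractNth j (· * ·) x)) := by
    funext z
    have h₀ : Fin.contractNth 0 (· * ·) (Fin.cons z x : Fin (n + 2) → G) =
        Fin.cons (z * x 0) fun i => x i.succ := by
      funext i
      refine Fin.cases ?_ (fun i => ?_) i <;> simp [Fin.contractNth]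
    have h₁ (j : Fin (n + 1)) : Fin.contractNth j.succ (· * ·) (Fin.cons z x : Fin (n + 2) → G) =
        Fin.cons z (Fin.contractNth j (· * ·) x) := by
      funext i
      refine Fin.cases ?_ (fun i => ?_) i <;> simp [Fin.contractNth]
    rw [cochainDiff_apply, Fin.sum_univ_succ, h₀]
    simp only [h₁, Fin.cons_zero, Fin.cons_succ, Pi.sub_apply, Finset.sum_apply, Pi.smul_apply,
      Pi.neg_apply, Fin.val_succ, Fin.val_zero, pow_succ, pow_zero, mul_neg, mul_one, neg_smul, one_smul,
      neg_neg, Finset.sum_neg_distrib]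
    abel
  rw [e, map_sub, map_sub, retraction_orbit, map_sum] at h
  rw [cochainDiff_apply, ← retraction_smul]
  simp only [map_smul] at h
  rw [sub_sub, sub_eq_zero] at h
  exact h.symm

end LocalDecomposition

end Decomposition
end Representation

/-! ### Cocycle criteria for vanishing, invariants, duality and coinvariants -/

open CategoryTheory TensorProduct

namespace Representation

section Conversion

variable {k G V : Type u} [CommRing k] [Group G] [AddCommGroup V] [Module k V]

theorem subsingleton_groupCohomology_iff (ρ : Representation k G V) (n : ℕ) :
    Subsingleton (groupCohomology (Rep.of ρ) (n + 1)) ↔ CocycleExact ρ n := by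
  rw [groupCohomology, ← ModuleCat.isZero_iff_subsingleton,
    ← HomologicalComplex.exactAt_iff_isZero_homology,
    HomologicalComplex.exactAt_iff' _ n (n + 1) (n + 1 + 1) (by simp) (by simp),
    ShortComplex.moduleCat_exact_iff]
  refine forall_congr' fun c => ?_
  change (((groupCohomology.inhomogeneousCochains (Rep.of ρ)).d (n + 1) (n + 1 + 1)).hom c = 0 →
    ∃ b, ((groupCohomology.inhomogeneousCochains (Rep.of ρ)).d n (n + 1)).hom b = c) ↔ _
  rw [groupCohomology.inhomogeneousCochains.d_def, groupCohomology.inhomogeneousCochains.d_def]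
  exact Iff.rfl

theorem subsingleton_groupHomology_iff (ρ : Representation k G V) (n : ℕ) :
    Subsingleton (groupHomology (Rep.of ρ) (n + 1)) ↔
      ∀ c, groupHomology.inhomogeneousChains.d (Rep.of ρ) n c = 0 →
        ∃ b, groupHomology.inhomogeneousChains.d (Rep.of ρ) (n + 1) b = c := by
  rw [groupHomology, ← ModuleCat.isZero_iff_subsingleton,
    ← HomologicalComplex.exactAt_iff_isZero_homology,
    HomologicalComplex.exactAt_iff' _ (n + 1 + 1) (n + 1) n (by simp) (by simp),
    ShortComplex.moduleCat_exact_iff]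
  refine forall_congr' fun c => ?_
  change (((groupHomology.inhomogeneousChains (Rep.of ρ)).d (n + 1) n).hom c = 0 →
    ∃ b, ((groupHomology.inhomogeneousChains (Rep.of ρ)).d (n + 1 + 1) (n + 1)).hom b = c) ↔ _
  rw [groupHomology.inhomogeneousChains.d_def, groupHomology.inhomogeneousChains.d_def]

end Conversion

section Invariants

variable {k G K V : Type u} [CommRing k] [Group G] [Group K] [AddCommGroup V] [Module k V]
  {σ : Representation k K V} {ρ : Representation k G V}

/-- The action of `G` on the invariants of a commuting action of `K`. -/
noncomputable def onInvariants (comm : ∀ g h v, ρ g (σ h v) = σ h (ρ g v)) :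
    Representation k G σ.invariants :=
  ρ.subrepresentation σ.invariants fun g v hv h => by rw [← comm, hv h]

theorem cocycleExact_onInvariants_iff (comm : ∀ g h v, ρ g (σ h v) = σ h (ρ g v)) (n : ℕ) :
    CocycleExact (onInvariants comm) n ↔ CocycleExactOn σ ρ n := by
  have coe (m : ℕ) (c : (Fin m → G) → σ.invariants) :
      cochainDiff ρ m (fun x => (c x : V)) = fun x => (cochainDiff (onInvariants comm) m c x : V) := by
    funext x
    rw [cochainDiff_apply, cochainDiff_apply]
    simp only [Submodule.coe_add, Submodule.coe_sum, Submodule.coe_smul]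
    rfl
  constructor
  · intro h c hc hd
    obtain ⟨b, hb⟩ := h (fun x => ⟨c x, fun g => hc g x⟩) (by
      funext x
      apply Subtype.ext
      rw [← congrFun (coe _ _) x]
      exact congrFun hd x)
    refine ⟨fun x => b x, fun g x => (b x).2 g, ?_⟩
    rw [coe, hb]
  · intro h c hc
    obtain ⟨b, hb, hd⟩ := h (fun x => c x) (fun g x => (c x).2 g) (by rw [coe, hc]; rfl)
    refine ⟨fun x => ⟨b x, fun g => hb g x⟩, ?_⟩
    funext x
    apply Subtype.ext
    rw [← congrFun (coe _ _) x]
    exact congrFun hd x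

end Invariants

section Duality

variable (k : Type u) [CommRing k]

variable {k} {G V : Type u} [Group G] [AddCommGroup V] [Module k V]

theorem exists_linearMap_characterModule_ne_zero {x : V} (hx : x ≠ 0) :
    ∃ f : V →ₗ[k] CharacterModule k, f x ≠ 0 := by
  obtain ⟨c, hc⟩ := CharacterModule.exists_character_apply_ne_zero_of_ne_zero hx
  refine ⟨CharacterModule.curry (c.comp (_root_.TensorProduct.rid k V).toAddMonoidHom), fun h => hc ?_⟩
  have h1 : c (_root_.TensorProduct.rid k V (x ⊗ₜ 1)) = 0 := DFunLike.congr_fun h 1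
  simpa using h1

/-- The character module of `k` is injective because `k` is flat over itself. -/
theorem exists_extension_characterModule {W : Type u} [AddCommGroup W] [Module k W]
    {f : V →ₗ[k] W} (hf : Function.Injective f) (u : V →ₗ[k] CharacterModule k) :
    ∃ u' : W →ₗ[k] CharacterModule k, u' ∘ₗ f = u :=
  rTensor_injective_iff_lcomp_surjective.1
    (Module.Flat.rTensor_preserves_injective_linearMap f hf) u

variable {A B C : Type u} [AddCommGroup A] [AddCommGroup B] [AddCommGroup C] [Module k A]
  [Module k B] [Module k C]

/-- `Hom(-, k⋆)` preserves and reflects exactness. -/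
theorem exact_iff_exact_characterModule (f : A →ₗ[k] B) (g : B →ₗ[k] C) :
    (∀ b, g b = 0 → ∃ a, f a = b) ↔ ∀ u : B →ₗ[k] CharacterModule k, u ∘ₗ f = 0 →
      ∃ v : C →ₗ[k] CharacterModule k, v ∘ₗ g = u := by
  constructor
  · intro h u hu
    have hker : LinearMap.ker g ≤ LinearMap.ker u := fun b hb => by
      obtain ⟨a, rfl⟩ := h b hb
      exact DFunLike.congr_fun hu a
    -- `u` factors through `B / ker g`, which embeds into `C`.
    obtain ⟨v, hv⟩ := exists_extension_characterModule
      (f := (LinearMap.ker g).liftQ g le_rfl)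
      (LinearMap.ker_eq_bot.1 (Submodule.ker_liftQ_eq_bot _ _ _ le_rfl))
      ((LinearMap.ker g).liftQ u hker)
    refine ⟨v, ?_⟩
    ext1 b
    exact DFunLike.congr_fun hv (Submodule.Quotient.mk b)
  · intro h b hb
    by_contra hne
    have : (LinearMap.range f).mkQ b ≠ 0 := fun h0 =>
      hne ((Submodule.Quotient.mk_eq_zero _).1 h0)
    obtain ⟨w, hw⟩ := exists_linearMap_characterModule_ne_zero (k := k) this
    obtain ⟨v, hv⟩ := h (w ∘ₗ (LinearMap.range f).mkQ) (by
      ext1 a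
      have : (LinearMap.range f).mkQ (f a) = 0 := (Submodule.Quotient.mk_eq_zero _).2 ⟨a, rfl⟩
      simp [this])
    refine hw ?_
    have := DFunLike.congr_fun hv b
    simpa [hb] using this.symm

/-- The action on `Hom(V, k⋆)` contragredient to `ρ`. -/
noncomputable abbrev characterDual (ρ : Representation k G V) :
    Representation k G (V →ₗ[k] CharacterModule k) :=
  linHom ρ (trivial k G (CharacterModule k))

theorem cochainDiff_characterDual (ρ : Representation k G V) (n : ℕ)
    (u : ((Fin n → G) →₀ V) →ₗ[k] CharacterModule k) :
    cochainDiff (characterDual ρ) n (fun x => u ∘ₗ Finsupp.lsingle x) = fun x =>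
      (u ∘ₗ (groupHomology.inhomogeneousChains.d (Rep.of ρ) n).hom) ∘ₗ Finsupp.lsingle x := by
  funext x
  ext1 v
  rw [cochainDiff_apply]
  simp [-groupHomology.inhomogeneousChains.d_single]
  erw [groupHomology.inhomogeneousChains.d_single]
  simp only [Finsupp.smul_single, map_add, map_sum, ← map_smul]

/-- `Hom(-, k⋆)` carries the inhomogeneous chain complex to the cochain complex of the dual and
detects exactness. -/
theorem subsingleton_groupHomology_iff_cocycleExact (ρ : Representation k G V) (n : ℕ) :
    Subsingleton (groupHomology (Rep.of ρ) (n + 1)) ↔ CocycleExact (characterDual ρ) n := by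
  rw [subsingleton_groupHomology_iff]
  refine (exact_iff_exact_characterModule
    (groupHomology.inhomogeneousChains.d (Rep.of ρ) (n + 1)).hom
    (groupHomology.inhomogeneousChains.d (Rep.of ρ) n).hom).trans ?_
  have ex (m : ℕ) (c : (Fin m → G) → V →ₗ[k] CharacterModule k) :
      ∃ u : ((Fin m → G) →₀ V) →ₗ[k] CharacterModule k, (fun x => u ∘ₗ Finsupp.lsingle x) = c :=
    ⟨Finsupp.lsum k c, by funext x; ext1 v; simp⟩
  have inj (m : ℕ) (u u' : ((Fin m → G) →₀ V) →ₗ[k] CharacterModule k) :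
      ((fun x => u ∘ₗ Finsupp.lsingle x) = fun x => u' ∘ₗ Finsupp.lsingle x) ↔ u = u' :=
    ⟨fun h => Finsupp.lhom_ext' (congrFun h), fun h => h ▸ rfl⟩
  constructor
  · intro h c hc
    obtain ⟨u, rfl⟩ := ex _ c
    rw [cochainDiff_characterDual] at hc
    obtain ⟨v, hv⟩ := h u ((inj _ _ 0).1 (by rw [hc]; rfl))
    exact ⟨_, (cochainDiff_characterDual ρ n v).trans (by rw [hv])⟩
  · intro h u hu
    obtain ⟨b, hb⟩ := h (fun x => u ∘ₗ Finsupp.lsingle x) (by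
      rw [cochainDiff_characterDual, hu]; rfl)
    obtain ⟨v, rfl⟩ := ex _ b
    rw [cochainDiff_characterDual] at hb
    exact ⟨v, (inj _ _ _).1 hb⟩

end Duality

section Coinvariants

variable {k G K V : Type u} [CommRing k] [Group G] [Group K] [AddCommGroup V] [Module k V]
  {σ : Representation k K V} {ρ : Representation k G V}

/-- The action of `G` on the coinvariants of a commuting action of `K`. -/
noncomputable def onCoinvariants (comm : ∀ g h v, ρ g (σ h v) = σ h (ρ g v)) :
    Representation k G σ.Coinvariants where
  toFun g := Coinvariants.lift σ (Coinvariants.mk σ ∘ₗ ρ g) fun h => by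
    ext v
    simp [comm]
  map_one' := by ext v; simp
  map_mul' g h := by ext v; simp

theorem onCoinvariants_mk (comm : ∀ g h v, ρ g (σ h v) = σ h (ρ g v)) (g : G) (v : V) :
    onCoinvariants comm g (Coinvariants.mk σ v) = Coinvariants.mk σ (ρ g v) := rfl

theorem characterDual_comm (comm : ∀ g h v, ρ g (σ h v) = σ h (ρ g v)) (g : G) (h : K)
    (v : V →ₗ[k] CharacterModule k) :
    characterDual ρ g (characterDual σ h v) = characterDual σ h (characterDual ρ g v) := by
  ext x
  simp [comm]

theorem cocycleExact_onCoinvariants_iff (comm : ∀ g h v, ρ g (σ h v) = σ h (ρ g v)) (n : ℕ) :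
    CocycleExact (characterDual (onCoinvariants comm)) n ↔
      CocycleExactOn (characterDual σ) (characterDual ρ) n := by
  have comp (m : ℕ) (c : (Fin m → G) → σ.Coinvariants →ₗ[k] CharacterModule k) :
      cochainDiff (characterDual ρ) m (fun x => c x ∘ₗ Coinvariants.mk σ) = fun x =>
        cochainDiff (characterDual (onCoinvariants comm)) m c x ∘ₗ Coinvariants.mk σ := by
    funext x
    ext1 v
    rw [cochainDiff_apply, cochainDiff_apply]
    simp [onCoinvariants_mk]
  have ex (m : ℕ) (c : (Fin m → G) → V →ₗ[k] CharacterModule k)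
      (hc : ∀ h x, characterDual σ h (c x) = c x) :
      ∃ b : (Fin m → G) → σ.Coinvariants →ₗ[k] CharacterModule k,
        (fun x => b x ∘ₗ Coinvariants.mk σ) = c :=
    ⟨fun x => Coinvariants.lift σ (c x) fun h => by
      have := hc h⁻¹ x
      ext1 v
      simpa using DFunLike.congr_fun this v, rfl⟩
  have inv (c : σ.Coinvariants →ₗ[k] CharacterModule k) (h : K) :
      characterDual σ h (c ∘ₗ Coinvariants.mk σ) = c ∘ₗ Coinvariants.mk σ := by
    ext1 v
    simp
  constructor
  · intro h c hc hd
    obtain ⟨c, rfl⟩ := ex _ c hc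
    rw [comp] at hd
    obtain ⟨b, rfl⟩ := h c (by funext x; exact Coinvariants.hom_ext (congrFun hd x))
    exact ⟨fun x => b x ∘ₗ Coinvariants.mk σ, fun g x => inv _ _, comp _ _⟩
  · intro h c hc
    obtain ⟨b, hb, hd⟩ := h (fun x => c x ∘ₗ Coinvariants.mk σ) (fun g x => inv _ _)
      (by rw [comp, hc]; rfl)
    obtain ⟨b, rfl⟩ := ex _ b hb
    rw [comp] at hd
    exact ⟨b, by funext x; exact Coinvariants.hom_ext (congrFun hd x)⟩

end Coinvariants

end Representation

/-! ### Finiteness properties of uniform embeddings -/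

section UniformEmbedding

variable {Λ : Type v} {Γ : Type w} [Group Λ] [Group Γ] {φ : Λ → Γ}

theorem not_tendsto_const_cofinite {α : Type*} (a : α) :
    ¬Tendsto (fun _ : ℕ => a) atTop cofinite := fun h => by
  obtain ⟨_, hne⟩ := (h.eventually (eventually_cofinite_ne a)).exists
  exact hne rfl

theorem tendsto_natEmbedding_cofinite {α : Type*} {s : Set α} (hs : s.Infinite) :
    Tendsto (fun i => (hs.natEmbedding s i : α)) atTop cofinite := by
  rw [← Nat.cofinite_eq_atTop]
  exact (Subtype.val_injective.comp (hs.natEmbedding s).injective).tendsto_cofinite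

/-- Infinitely many values would give a sequence leaving all finite subsets of `Γ`, forcing the
constant sequence `l` to leave all finite subsets of `Λ`. `finite_fiber` uses the other implication
in the same way. -/
theorem IsUniformGroupEmbedding.finite_range (hφ : IsUniformGroupEmbedding φ) (l : Λ) :
    (Set.range fun x => (φ x)⁻¹ * φ (x * l)).Finite := by
  by_contra hs
  have ht := tendsto_natEmbedding_cofinite hs
  choose x hx using fun i => (Set.Infinite.natEmbedding _ hs i).2
  simp only [← hx] at ht
  have := (hφ x fun i => x i * l).2 ht
  simp only [inv_mul_cancel_left] at this
  exact not_tendsto_const_cofinite l this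

theorem IsUniformGroupEmbedding.finite_fiber (hφ : IsUniformGroupEmbedding φ) (γ : Γ) :
    {l : Λ | ∃ x, (φ x)⁻¹ * φ (x * l) = γ}.Finite := by
  by_contra hs
  have ht := tendsto_natEmbedding_cofinite hs
  choose x hx using fun i => (Set.Infinite.natEmbedding _ hs i).2
  have := (hφ x fun i => x i * (Set.Infinite.natEmbedding _ hs i : Λ)).1
    (by simpa only [inv_mul_cancel_left] using ht)
  simp only [hx] at this
  exact not_tendsto_const_cofinite γ this

end UniformEmbedding

/-! ### Local decompositions from equivariant maps -/

namespace Representation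

section Decomposition

variable {k G M Z : Type u} [CommRing k] [Group G] [AddCommGroup M] [Module k M]

open Classical in
/-- A module of functions on a right `G`-set `Z` which is stable under restriction to subsets has a
local decomposition if there is an equivariant map `c : Z → G` which takes only finitely many
values on the support of each function. -/
noncomputable def LocalDecomposition.ofEquivariantMap {W : Submodule k (Z → M)}
    (ρ : Representation k G W) (α : Representation k G M) (act : Z → G → Z)
    (hρ : ∀ g (f : W) z, (ρ g f : Z → M) z = α g ((f : Z → M) (act z g)))
    (c : Z → G) (hc : ∀ z g, c (act z g) = c z * g)
    (hW : ∀ f ∈ W, ∀ s : Set Z, s.indicator f ∈ W)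
    (hfin : ∀ f ∈ W, (c '' Function.support f).Finite) : LocalDecomposition ρ where
  parts :=
    { toFun := fun f => Finsupp.onFinset (hfin f f.2).toFinset
        (fun g => ρ g ⟨(c ⁻¹' {g}).indicator (f : Z → M), hW f f.2 _⟩) fun g hg => by
          rw [Set.Finite.mem_toFinset]
          by_contra hne
          refine hg ?_
          have : (⟨(c ⁻¹' {g}).indicator (f : Z → M), hW f f.2 _⟩ : W) = 0 := by
            refine Subtype.ext (funext fun z => ?_)
            refine Set.indicator_apply_eq_zero.2 fun hz => ?_
            by_contra h0
            exact hne ⟨z, h0, hz⟩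
          rw [this, map_zero]
      map_add' := fun f f' => by
        ext1 g
        simp only [Finsupp.onFinset_apply, Finsupp.add_apply, ← map_add]
        exact congrArg _ (Subtype.ext (Set.indicator_add _ _ _))
      map_smul' := fun r f => by
        ext1 g
        simp only [Finsupp.onFinset_apply, Finsupp.smul_apply, ← map_smul, RingHom.id_apply]
        exact congrArg _ (Subtype.ext (Set.indicator_const_smul (c ⁻¹' {g}) r (f : Z → M))) }
  parts_smul g f h := by
    refine Subtype.ext (funext fun z => ?_)
    simp only [LinearMap.coe_mk, AddHom.coe_mk, Finsupp.onFinset_apply, hρ, Set.indicator_apply,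
      Set.mem_preimage, Set.mem_singleton_iff, hc, map_mul, Module.End.mul_apply,
      mul_left_inj]
    split_ifs <;> simp [*]
  sum_parts f := by
    rw [LinearMap.coe_mk, AddHom.coe_mk, Finsupp.onFinset_sum _ (by simp)]
    simp only [inv_self_apply]
    refine Subtype.ext (funext fun z => ?_)
    rw [Submodule.coe_sum, Finset.sum_apply]
    simp only [Set.indicator_apply, Set.mem_preimage, Set.mem_singleton_iff, Finset.sum_ite_eq,
      Set.Finite.mem_toFinset]
    split_ifs with h
    · rfl
    · by_contra h0
      exact h ⟨z, Ne.symm h0, rfl⟩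

open Classical in
theorem LocalDecomposition.ofEquivariantMap_parts_apply {W : Submodule k (Z → M)}
    (ρ : Representation k G W) (α : Representation k G M) (act : Z → G → Z)
    (hρ : ∀ g (f : W) z, (ρ g f : Z → M) z = α g ((f : Z → M) (act z g)))
    (c : Z → G) (hc : ∀ z g, c (act z g) = c z * g)
    (hW : ∀ f ∈ W, ∀ s : Set Z, s.indicator f ∈ W)
    (hfin : ∀ f ∈ W, (c '' Function.support f).Finite) (f : W) (g : G) (z : Z) :
    ((ofEquivariantMap ρ α act hρ c hc hW hfin).parts f g : Z → M) z =
      if c z = 1 then α g ((f : Z → M) (act z g)) else 0 := by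
  change (ρ g ⟨(c ⁻¹' {g}).indicator (f : Z → M), hW f f.2 _⟩ : Z → M) z = _
  simp only [hρ, Set.indicator_apply, Set.mem_preimage, Set.mem_singleton_iff, hc, mul_eq_right]
  split_ifs <;> simp

variable {P : Type u} [AddCommGroup P] [Module k P] {ρ : Representation k G P}

/-- The sum of the parts of an element, an element with the same class in the coinvariants. -/
noncomputable def LocalDecomposition.gather (D : LocalDecomposition ρ) : P →ₗ[k] P :=
  Finsupp.lsum k (fun _ => LinearMap.id) ∘ₗ D.parts

theorem LocalDecomposition.gather_apply (D : LocalDecomposition ρ) (x : P) :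
    D.gather x = (D.parts x).sum fun _ y => y := rfl

theorem LocalDecomposition.map_gather {N : Type*} [AddCommGroup N] [Module k N]
    (D : LocalDecomposition ρ) (u : P →ₗ[k] N) (hu : ∀ g x, u (ρ g x) = u x) (x : P) :
    u (D.gather x) = u x := by
  conv_rhs => rw [← D.sum_parts x]
  rw [gather_apply, map_finsuppSum, map_finsuppSum]
  simp only [hu]

end Decomposition

end Representation

/-! ### Functions near the graph and their two actions -/

section NearGraph

variable {R Λ Γ M : Type u} [CommRing R] [Group Λ] [Group Γ] [AddCommGroup M] [Module R M]

/-- The functions on `Λ × Γ` with finitely many values whose support lies within finite distance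
from the graph of `φ`. -/
def nearGraph (R : Type u) {Λ Γ : Type u} (M : Type u) [CommRing R] [Group Λ] [Group Γ]
    [AddCommGroup M] [Module R M] (φ : Λ → Γ) : Submodule R (Λ × Γ → M) where
  carrier := {f | (Set.range f).Finite ∧
    ((fun z : Λ × Γ => (φ z.1)⁻¹ * z.2) '' Function.support f).Finite}
  zero_mem' := ⟨(Set.finite_singleton (0 : M)).subset (by rintro _ ⟨x, rfl⟩; rfl), by simp⟩
  add_mem' := fun {f f'} hf hf' => by
    refine ⟨(hf.1.add hf'.1).subset ?_, (hf.2.union hf'.2).subset ?_⟩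
    · rintro _ ⟨z, rfl⟩
      exact Set.add_mem_add ⟨z, rfl⟩ ⟨z, rfl⟩
    · rw [← Set.image_union]
      exact Set.image_mono (Function.support_add _ _)
  smul_mem' := fun r f hf => by
    refine ⟨(hf.1.image (r • ·)).subset ?_,
      hf.2.subset (Set.image_mono (Function.support_const_smul_subset _ _))⟩
    rintro _ ⟨z, rfl⟩
    exact ⟨f z, ⟨z, rfl⟩, rfl⟩

namespace nearGraph

variable {φ : Λ → Γ}

theorem indicator_mem {f : Λ × Γ → M} (hf : f ∈ nearGraph R M φ) (s : Set (Λ × Γ)) :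
    s.indicator f ∈ nearGraph R M φ := by
  refine ⟨(hf.1.union (Set.finite_singleton 0)).subset ?_,
    hf.2.subset (Set.image_mono (by rw [Set.support_indicator]; exact Set.inter_subset_right))⟩
  rintro _ ⟨z, rfl⟩
  by_cases hz : z ∈ s
  · rw [Set.indicator_of_mem hz]
    exact Or.inl ⟨z, rfl⟩
  · rw [Set.indicator_of_notMem hz]
    exact Or.inr rfl

/-- The action of `Λ` on functions near the graph of `φ`, combined with an action on the values. -/
def leftRep (hφ : IsUniformGroupEmbedding φ) (τ : Representation R Λ M) :
    Representation R Λ (nearGraph R M φ) where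
  toFun l :=
    { toFun := fun f => ⟨fun z => τ l ((f : Λ × Γ → M) (z.1 * l, z.2)), by
        refine ⟨(f.2.1.image (τ l)).subset ?_, ((hφ.finite_range l).mul f.2.2).subset ?_⟩
        · rintro _ ⟨z, rfl⟩
          exact ⟨_, ⟨_, rfl⟩, rfl⟩
        · rintro _ ⟨z, hz, rfl⟩
          refine ⟨_, ⟨z.1, rfl⟩, _, ⟨(z.1 * l, z.2), fun h => hz ?_, rfl⟩, ?_⟩
          · change τ l _ = 0
            rw [h, map_zero]
          · simp [mul_assoc]⟩
      map_add' := fun f f' => by ext z; simp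
      map_smul' := fun r f => by ext z; simp }
  map_one' := by ext f z; simp
  map_mul' l l' := by ext f z; simp [mul_assoc]

/-- The action of `Γ` on functions near the graph of `φ`. -/
def rightRep (R M : Type u) [CommRing R] [AddCommGroup M] [Module R M] (φ : Λ → Γ) :
    Representation R Γ (nearGraph R M φ) where
  toFun γ :=
    { toFun := fun f => ⟨fun z => (f : Λ × Γ → M) (z.1, z.2 * γ), by
        refine ⟨f.2.1.subset ?_, (f.2.2.mul (Set.finite_singleton γ⁻¹)).subset ?_⟩
        · rintro _ ⟨z, rfl⟩
          exact ⟨_, rfl⟩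
        · rintro _ ⟨z, hz, rfl⟩
          exact ⟨_, ⟨(z.1, z.2 * γ), hz, rfl⟩, _, rfl, by simp [mul_assoc]⟩⟩
      map_add' := fun f f' => by ext z; simp
      map_smul' := fun r f => by ext z; simp }
  map_one' := by ext f z; simp
  map_mul' l l' := by ext f z; simp [mul_assoc]

theorem leftRep_rightRep (hφ : IsUniformGroupEmbedding φ) (τ : Representation R Λ M) (l : Λ)
    (γ : Γ) (f : nearGraph R M φ) :
    leftRep hφ τ l (rightRep R M φ γ f) = rightRep R M φ γ (leftRep hφ τ l f) := rfl

/-- The local decomposition of the functions near the graph of `φ` along `Γ`. -/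
noncomputable def rightDecomposition (R M : Type u) [CommRing R] [AddCommGroup M] [Module R M]
    (φ : Λ → Γ) : (rightRep R M φ).LocalDecomposition :=
  .ofEquivariantMap _ (Representation.trivial R Γ M) (fun z γ => (z.1, z.2 * γ))
    (fun g f z => rfl) (fun z => (φ z.1)⁻¹ * z.2)
    (fun z g => by simp [mul_assoc]) (fun f hf s => indicator_mem hf s) (fun f hf => hf.2)

theorem exists_leftDecomposition [Countable Γ] (hφ : IsUniformGroupEmbedding φ)
    (τ : Representation R Λ M) : Nonempty (leftRep hφ τ).LocalDecomposition := by
  obtain ⟨e, he⟩ := exists_injective_nat Γ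
  -- The injection `e` serves as a norm with finite balls; `ψ y` is a point whose image is nearest
  -- to `y`.
  have hψ (y : Γ) : ∃ x, ∀ x', e ((φ x)⁻¹ * y) ≤ e ((φ x')⁻¹ * y) :=
    ⟨Function.argmin fun x => e ((φ x)⁻¹ * y), fun x' => Function.argmin_le (fun x => e ((φ x)⁻¹ * y)) x'⟩
  choose ψ hψ using hψ
  refine ⟨.ofEquivariantMap _ τ (fun z l => (z.1 * l, z.2))
    (fun g f z => rfl) (fun z => (ψ z.2)⁻¹ * z.1) (fun z g => by simp [mul_assoc])
    (fun f hf s => indicator_mem hf s) fun f hf => ?_⟩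
  -- On the support of `f`, `z.2` is within `N` of `φ z.1`, hence by minimality also of `φ (ψ z.2)`.
  -- So `φ (ψ z.2)⁻¹ * φ z.1` takes finitely many values, and `finite_fiber` bounds `(ψ z.2)⁻¹ *
  -- z.1`.
  obtain ⟨N, hN⟩ := (hf.2.image e).bddAbove
  have hS : {γ | e γ ≤ N}.Finite := (Set.finite_Iic N).preimage he.injOn
  refine ((hS.mul hf.2.inv).biUnion fun γ _ => hφ.finite_fiber γ).subset ?_
  rintro _ ⟨z, hz, rfl⟩
  have hz' : (φ z.1)⁻¹ * z.2 ∈ (fun z : Λ × Γ => (φ z.1)⁻¹ * z.2) '' Function.support f :=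
    ⟨z, hz, rfl⟩
  refine Set.mem_biUnion (x := (φ (ψ z.2))⁻¹ * z.2 * ((φ z.1)⁻¹ * z.2)⁻¹)
    (Set.mul_mem_mul ((hψ z.2 z.1).trans (hN ⟨_, hz', rfl⟩)) (Set.inv_mem_inv.2 hz'))
    ⟨ψ z.2, ?_⟩
  simp [mul_assoc]

/-- The function on the graph of `φ` with constant value `m`. -/
noncomputable def graph (R : Type u) {M : Type u} [CommRing R] [AddCommGroup M] [Module R M]
    (φ : Λ → Γ) : M →ₗ[R] nearGraph R M φ where
  toFun m := ⟨{z | z.2 = φ z.1}.indicator fun _ => m, by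
    refine ⟨((Set.finite_singleton m).union (Set.finite_singleton 0)).subset ?_,
      (Set.finite_singleton 1).subset ?_⟩
    · rintro _ ⟨z, rfl⟩
      by_cases hz : z ∈ {z : Λ × Γ | z.2 = φ z.1}
      · exact Or.inl (Set.indicator_of_mem hz _)
      · exact Or.inr (Set.indicator_of_notMem hz _)
    · rintro _ ⟨z, hz, rfl⟩
      have : z.2 = φ z.1 := Set.mem_of_indicator_ne_zero (s := {z : Λ × Γ | z.2 = φ z.1}) hz
      simp [this]⟩
  map_add' m m' := Subtype.ext (Set.indicator_add _ (fun _ => m) fun _ => m')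
  map_smul' r m := Subtype.ext (Set.indicator_const_smul _ r fun _ => m)

open Classical in
theorem graph_apply (m : M) (z : Λ × Γ) :
    (graph R φ m : Λ × Γ → M) z = if z.2 = φ z.1 then m else 0 := by
  change Set.indicator {z | z.2 = φ z.1} (fun _ => m) z = _
  rw [Set.indicator_apply]
  exact if_congr Iff.rfl rfl rfl

/-- The sum over the fiber at `x`. -/
noncomputable def fiberSum (R M : Type u) [CommRing R] [AddCommGroup M] [Module R M] (φ : Λ → Γ) :
    nearGraph R M φ →ₗ[R] (Λ → M) where
  toFun f x := ((rightDecomposition R M φ).gather f : Λ × Γ → M) (x, φ x)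
  map_add' f f' := by ext x; simp
  map_smul' r f := by ext x; simp

-- Gathering moves the whole mass of each fibre `{x} × Γ` to its point on the graph.
open Classical in
theorem gather_apply (f : nearGraph R M φ) (z : Λ × Γ) :
    ((rightDecomposition R M φ).gather f : Λ × Γ → M) z =
      if z.2 = φ z.1 then ∑ᶠ y, (f : Λ × Γ → M) (z.1, y) else 0 := by
  have hp (g : Γ) (z : Λ × Γ) : ((rightDecomposition R M φ).parts f g : Λ × Γ → M) z =
      if (φ z.1)⁻¹ * z.2 = 1 then (f : Λ × Γ → M) (z.1, z.2 * g) else 0 :=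
    Representation.LocalDecomposition.ofEquivariantMap_parts_apply ..
  rw [Representation.LocalDecomposition.gather_apply, Finsupp.sum, Submodule.coe_sum,
    Finset.sum_apply]
  simp only [hp, inv_mul_eq_one, eq_comm (a := φ z.1)]
  split_ifs with hz
  · rw [← finsum_comp_equiv (Equiv.mulLeft (φ z.1)), hz]
    symm
    refine finsum_eq_sum_of_support_subset _ fun g hg => ?_
    rw [Finset.mem_coe, Finsupp.mem_support_iff]
    intro h0
    refine hg ?_
    have := hp g (z.1, φ z.1)
    rw [h0] at this
    simpa using this.symm
  · simp

theorem fiberSum_apply (f : nearGraph R M φ) (x : Λ) :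
    fiberSum R M φ f x = ∑ᶠ y, (f : Λ × Γ → M) (x, y) := by
  change ((rightDecomposition R M φ).gather f : Λ × Γ → M) (x, φ x) = _
  rw [gather_apply, if_pos rfl]

theorem fiberSum_rightRep (γ : Γ) (f : nearGraph R M φ) :
    fiberSum R M φ (rightRep R M φ γ f) = fiberSum R M φ f := by
  funext x
  rw [fiberSum_apply, fiberSum_apply]
  exact finsum_comp_equiv (Equiv.mulRight γ) (f := fun y => (f : Λ × Γ → M) (x, y))

theorem fiberSum_graph (m : M) (x : Λ) : fiberSum R M φ (graph R φ m) x = m := by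
  classical
  rw [fiberSum_apply, finsum_eq_single _ (φ x) fun y hy => by rw [graph_apply, if_neg hy],
    graph_apply, if_pos rfl]

theorem fiberSum_leftRep (hφ : IsUniformGroupEmbedding φ) (τ : Representation R Λ M) (l : Λ)
    (f : nearGraph R M φ) (x : Λ) :
    fiberSum R M φ (leftRep hφ τ l f) x = τ l (fiberSum R M φ f (x * l)) := by
  rw [fiberSum_apply, fiberSum_apply]
  refine ((τ l).toAddMonoidHom.map_finsum ?_).symm
  refine (f.2.2.image (φ (x * l) * ·)).subset fun y hy => ?_
  exact ⟨_, ⟨(x * l, y), hy, rfl⟩, by simp⟩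

theorem finite_range_fiberSum (f : nearGraph R M φ) : (Set.range (fiberSum R M φ f)).Finite := by
  refine ((rightDecomposition R M φ).gather f).2.1.subset ?_
  rintro _ ⟨x, rfl⟩
  exact ⟨_, rfl⟩

theorem gather_leftRep_graph (hφ : IsUniformGroupEmbedding φ) (τ : Representation R Λ M) (l : Λ)
    (m : M) :
    (rightDecomposition R M φ).gather (leftRep hφ τ l (graph R φ m)) = graph R φ (τ l m) := by
  classical
  refine Subtype.ext (funext fun z => ?_)
  rw [gather_apply, graph_apply, ← fiberSum_apply, fiberSum_leftRep, fiberSum_graph]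

end nearGraph

end NearGraph

/-! ### Invariant means with values in `R` -/

section Mean

/-- A `ℚ`-linear projection `ℝ → ℚ` fixing `1` makes the mean rational, hence `R`-valued; positivity
is lost but only additivity is needed later. Inversion on the group exchanges left and right
invariance. -/
theorem IsAmenableGroup.exists_right_invariant_mean {Λ : Type v} [Group Λ] {R : Type u} [CommRing R]
    (h : IsAmenableGroup Λ) (ι : ℚ →+* R) :
    ∃ μ : Set Λ → R, μ Set.univ = 1 ∧ (∀ s t, Disjoint s t → μ (s ∪ t) = μ s + μ t) ∧
      ∀ l s, μ ((· * l) ⁻¹' s) = μ s := by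
  obtain ⟨m, -, huniv, hadd, hinv⟩ := h
  obtain ⟨p, hp⟩ := LinearMap.exists_leftInverse_of_injective (LinearMap.toSpanSingleton ℚ ℝ 1)
    (LinearMap.ker_eq_bot.2 (smul_left_injective ℚ one_ne_zero))
  have hp1 : p 1 = 1 := by simpa using DFunLike.congr_fun hp 1
  refine ⟨fun s => ι (p (m s⁻¹)), by simp [huniv, hp1], fun s t hst => ?_, fun l s => ?_⟩
  · simp only [Set.union_inv]
    rw [hadd s⁻¹ t⁻¹ (Set.disjoint_left.2 fun x hx hx' => Set.disjoint_left.1 hst hx hx'), map_add,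
      map_add]
  · have : ((· * l) ⁻¹' s)⁻¹ = l • s⁻¹ := by
      ext x
      simp [Set.mem_smul_set_iff_inv_smul_mem]
    simp only [this, hinv]

/-- The integral of a function with finitely many values. -/
noncomputable def meanIntegral {X R M : Type*} [Semiring R] [AddCommMonoid M] [Module R M]
    (μ : Set X → R) (a : X → M) : M :=
  ∑ᶠ m, μ (a ⁻¹' {m}) • m

variable {X R M N : Type*} [CommRing R] [AddCommGroup M] [Module R M] {μ : Set X → R}

theorem mean_preimage_finset (hμ : ∀ s t, Disjoint s t → μ (s ∪ t) = μ s + μ t) (b : X → N)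
    (t : Finset N) : μ (b ⁻¹' t) = ∑ n ∈ t, μ (b ⁻¹' {n}) := by
  classical
  induction t using Finset.induction_on with
  | empty => simpa using hμ ∅ ∅ (Set.disjoint_empty _)
  | insert n t hn ih =>
    rw [Finset.sum_insert hn, ← ih, ← hμ _ _ (Disjoint.preimage b (by simpa using hn)),
      ← Set.preimage_union, Finset.coe_insert, Set.insert_eq]

theorem meanIntegral_comp (hμ : ∀ s t, Disjoint s t → μ (s ∪ t) = μ s + μ t) {b : X → N}
    {s : Finset N} (hb : ∀ x, b x ∈ s) (h : N → M) :
    meanIntegral μ (h ∘ b) = ∑ n ∈ s, μ (b ⁻¹' {n}) • h n := by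
  classical
  have h0 : μ ∅ = 0 := by simpa using hμ ∅ ∅ (Set.disjoint_empty _)
  rw [meanIntegral, finsum_eq_sum_of_support_subset (s := s.image h),
    ← Finset.sum_fiberwise_of_maps_to (fun n hn => Finset.mem_image_of_mem h hn)]
  · refine Finset.sum_congr rfl fun m _ => ?_
    have : (h ∘ b) ⁻¹' {m} = b ⁻¹' (s.filter fun n => h n = m : Finset N) := by
      ext x
      simp [hb x]
    rw [this, mean_preimage_finset hμ, Finset.sum_smul]
    exact Finset.sum_congr rfl fun n hn => by rw [(Finset.mem_filter.1 hn).2]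
  · intro m hm
    by_contra hne
    refine hm ?_
    have : (h ∘ b) ⁻¹' {m} = ∅ := by
      ext x
      simp only [Set.mem_preimage, Set.mem_singleton_iff, Set.mem_empty_iff_false, iff_false]
      rintro rfl
      exact hne (Finset.mem_coe.2 (Finset.mem_image_of_mem h (hb x)))
    change μ _ • m = 0
    rw [this, h0, zero_smul]

theorem meanIntegral_add (hμ : ∀ s t, Disjoint s t → μ (s ∪ t) = μ s + μ t) {a a' : X → M}
    (ha : (Set.range a).Finite) (ha' : (Set.range a').Finite) :
    meanIntegral μ (a + a') = meanIntegral μ a + meanIntegral μ a' := by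
  -- Both functions and their sum factor through the pair, so all three integrals run over one
  -- finite partition.
  have hs (x : X) : (a x, a' x) ∈ ha.toFinset ×ˢ ha'.toFinset := by simp
  have key (h : M × M → M) := meanIntegral_comp hμ hs h
  have h₁ := key fun z => z.1 + z.2
  have h₂ := key Prod.fst
  have h₃ := key Prod.snd
  simp only [smul_add, Finset.sum_add_distrib] at h₁
  exact h₁.trans (congrArg₂ (· + ·) h₂.symm h₃.symm)

theorem meanIntegral_map {M' : Type*} [AddCommGroup M'] [Module R M']
    (hμ : ∀ s t, Disjoint s t → μ (s ∪ t) = μ s + μ t) {a : X → M} (ha : (Set.range a).Finite)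
    (f : M →ₗ[R] M') : meanIntegral μ (fun x => f (a x)) = f (meanIntegral μ a) := by
  have hs (x : X) : a x ∈ ha.toFinset := by simp
  have h₁ := meanIntegral_comp hμ hs f
  have h₂ := meanIntegral_comp hμ hs (id : M → M)
  refine h₁.trans (Eq.trans ?_ (congrArg f h₂.symm))
  simp

theorem meanIntegral_const (hμ : ∀ s t, Disjoint s t → μ (s ∪ t) = μ s + μ t)
    (huniv : μ Set.univ = 1) (m : M) : meanIntegral μ (fun _ => m) = m := by
  refine (meanIntegral_comp hμ (b := fun _ => m) (s := {m}) (by simp) id).trans ?_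
  simp [huniv]

end Mean

/-! ### Retractions onto constant functions on the graph -/

namespace nearGraph

variable {R Λ Γ M : Type u} [CommRing R] [Group Λ] [Group Γ] [AddCommGroup M] [Module R M]
  {φ : Λ → Γ}

/-- The fibre sum at `1 ∈ Λ` works over any `R`; equivariance under `Λ` is not claimed. The next
lemma gains it by averaging fibre sums over all of `Λ`. -/
theorem exists_invariant_retraction (R M : Type u) [CommRing R] [AddCommGroup M] [Module R M]
    (φ : Λ → Γ) : ∃ J : nearGraph R M φ →ₗ[R] M,
      (∀ γ f, J (rightRep R M φ γ f) = J f) ∧ ∀ m, J (graph R φ m) = m :=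
  ⟨LinearMap.proj 1 ∘ₗ fiberSum R M φ, fun γ f => by simp [fiberSum_rightRep],
    fun m => by simp [fiberSum_graph]⟩

theorem exists_equivariant_retraction (hφ : IsUniformGroupEmbedding φ) (hΛ : IsAmenableGroup Λ)
    (ι : ℚ →+* R) (τ : Representation R Λ M) : ∃ J : nearGraph R M φ →ₗ[R] M,
      (∀ γ f, J (rightRep R M φ γ f) = J f) ∧ (∀ m, J (graph R φ m) = m) ∧
        ∀ l f, J (leftRep hφ τ l f) = τ l (J f) := by
  obtain ⟨μ, huniv, hadd, hinv⟩ := hΛ.exists_right_invariant_mean ι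
  refine ⟨{ toFun := fun f => meanIntegral μ (fiberSum R M φ f)
            map_add' := fun f f' => ?_
            map_smul' := fun r f => ?_ }, fun γ f => ?_, fun m => ?_, fun l f => ?_⟩
  · rw [map_add]
    exact meanIntegral_add hadd (finite_range_fiberSum f) (finite_range_fiberSum f')
  · rw [map_smul]
    exact meanIntegral_map hadd (finite_range_fiberSum f) (LinearMap.lsmul R M r)
  · simp [fiberSum_rightRep]
  · have : fiberSum R M φ (graph R φ m) = fun _ => m := funext (fiberSum_graph m)
    simp [this, meanIntegral_const hadd huniv]
  · have : fiberSum R M φ (leftRep hφ τ l f) = fun x => τ l (fiberSum R M φ f (x * l)) :=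
      funext (fiberSum_leftRep hφ τ l f)
    have hfin : (Set.range fun x => fiberSum R M φ f (x * l)).Finite :=
      (finite_range_fiberSum f).subset (Set.range_comp_subset_range (· * l) _)
    simp only [LinearMap.coe_mk, AddHom.coe_mk, this]
    rw [meanIntegral_map hadd hfin]
    refine congrArg _ (finsum_congr fun m => ?_)
    rw [← hinv l (fiberSum R M φ f ⁻¹' {m})]
    rfl

end nearGraph

/-! ### Vanishing for the auxiliary modules and transfer to `M` -/

open CategoryTheory Limits Representation

section Vanishing

variable {R Λ Γ : Type u} [CommRing R] [Group Λ] [Group Γ]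

theorem isZero_groupCohomology_of_epi {n : ℕ} {A B : Rep.{u} R Λ} (f : A ⟶ B) [Epi f]
    (hA : IsZero (groupCohomology A n))
    (h : ∀ K : Rep.{u} R Λ, IsZero (groupCohomology K (n + 1))) :
    IsZero (groupCohomology B n) := by
  have hS : (ShortComplex.mk (kernel.ι f) f (kernel.condition f)).ShortExact :=
    { exact := ShortComplex.exact_kernel f }
  have := groupCohomology.mono_δ_of_isZero hS n hA
  exact IsZero.of_mono (groupCohomology.δ hS n (n + 1) rfl) (h _)

theorem isZero_groupCohomology_of_retract {n : ℕ} {A B : Rep.{u} R Λ} (f : A ⟶ B) (s : B ⟶ A)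
    (hs : s ≫ f = 𝟙 B) (hA : IsZero (groupCohomology A n)) : IsZero (groupCohomology B n) := by
  have hA' : IsZero ((groupCohomology.functor R Λ n).obj A) := hA
  have h := (groupCohomology.functor R Λ n).map_comp s f
  rw [hs, CategoryTheory.Functor.map_id, hA'.eq_of_src ((groupCohomology.functor R Λ n).map f) 0,
    comp_zero] at h
  exact (IsZero.iff_id_eq_zero _).2 h

theorem isZero_groupHomology_of_mono {n : ℕ} {A B : Rep.{u} R Λ} (f : B ⟶ A) [Mono f]
    (hA : IsZero (groupHomology A n))
    (h : ∀ K : Rep.{u} R Λ, IsZero (groupHomology K (n + 1))) :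
    IsZero (groupHomology B n) := by
  have hS : (ShortComplex.mk f (cokernel.π f) (cokernel.condition f)).ShortExact :=
    { exact := ShortComplex.exact_cokernel f }
  have := groupHomology.epi_δ_of_isZero hS n hA
  exact IsZero.of_epi (groupHomology.δ hS (n + 1) n rfl) (h _)

theorem isZero_groupHomology_of_retract {n : ℕ} {A B : Rep.{u} R Λ} (f : A ⟶ B) (s : B ⟶ A)
    (hs : s ≫ f = 𝟙 B) (hA : IsZero (groupHomology A n)) : IsZero (groupHomology B n) := by
  have hA' : IsZero ((groupHomology.functor R Λ n).obj A) := hA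
  have h := (groupHomology.functor R Λ n).map_comp s f
  rw [hs, CategoryTheory.Functor.map_id, hA'.eq_of_src ((groupHomology.functor R Λ n).map f) 0,
    comp_zero] at h
  exact (IsZero.iff_id_eq_zero _).2 h

variable {φ : Λ → Γ} (hφ : IsUniformGroupEmbedding φ)

namespace nearGraph

section Cohomology

variable {M : Type u} [AddCommGroup M] [Module R M] (τ : Representation R Λ M)

/-- The action of `Λ` on `M`-valued measures near the graph of `φ`. -/
noncomputable abbrev measureLeft : Representation R Λ (nearGraph R R φ →ₗ[R] M) :=
  linHom (leftRep hφ (trivial R Λ R)) τ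

/-- The action of `Γ` on `M`-valued measures near the graph of `φ`. -/
noncomputable abbrev measureRight (R : Type u) [CommRing R] (M : Type u) [AddCommGroup M]
    [Module R M] (φ : Λ → Γ) : Representation R Γ (nearGraph R R φ →ₗ[R] M) :=
  linHom (rightRep R R φ) (trivial R Γ M)

theorem measureLeft_measureRight (l : Λ) (γ : Γ) (u : nearGraph R R φ →ₗ[R] M) :
    measureLeft hφ τ l (measureRight R M φ γ u) = measureRight R M φ γ (measureLeft hφ τ l u) := by
  ext f
  simp [leftRep_rightRep]

/-- The `Λ`-representation of `Γ`-invariant `M`-valued measures near the graph of `φ`. -/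
noncomputable abbrev invariantMeasures :
    Representation R Λ (measureRight R M φ).invariants :=
  onInvariants (measureLeft_measureRight hφ τ)

theorem isZero_groupCohomology_invariantMeasures [Countable Γ] {n : ℕ}
    (h : ∀ N : Rep.{u} R Γ, IsZero (groupCohomology N (n + 1))) :
    IsZero (groupCohomology (Rep.of (invariantMeasures hφ τ)) (n + 1)) := by
  obtain ⟨D⟩ := exists_leftDecomposition hφ (trivial R Λ R)
  rw [ModuleCat.isZero_iff_subsingleton, subsingleton_groupCohomology_iff,
    cocycleExact_onInvariants_iff]
  refine CocycleExactOn.of_commute (measureLeft_measureRight hφ τ) (D.cocycleExact_linHom τ)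
    ((rightDecomposition R R φ).cocycleExact_linHom _) ?_
  rw [← cocycleExact_onInvariants_iff fun γ l u => (measureLeft_measureRight hφ τ l γ u).symm,
    ← subsingleton_groupCohomology_iff, ← ModuleCat.isZero_iff_subsingleton]
  exact h _

theorem apply_rightRep (u : (measureRight R M φ).invariants) (γ : Γ) (f : nearGraph R R φ) :
    (u : nearGraph R R φ →ₗ[R] M) (rightRep R R φ γ f) = (u : nearGraph R R φ →ₗ[R] M) f := by
  simpa using DFunLike.congr_fun (u.2 γ⁻¹) f

/-- The total mass on the graph of `φ`. -/
noncomputable def evalGraph : Rep.of (invariantMeasures hφ τ) ⟶ Rep.of τ :=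
  Rep.ofHom
    { toFun := fun u => (u : nearGraph R R φ →ₗ[R] M) (graph R φ 1)
      map_add' := fun u v => by simp
      map_smul' := fun r u => by simp
      isIntertwining' := fun l => by
        ext u
        change τ l ((u : nearGraph R R φ →ₗ[R] M) (leftRep hφ (trivial R Λ R) l⁻¹ (graph R φ 1))) =
          τ l ((u : nearGraph R R φ →ₗ[R] M) (graph R φ 1))
        -- A `Λ`-translate of the graph indicator still has total mass `1` on each fibre, so it
        -- gathers back to the indicator.
        rw [← (rightDecomposition R R φ).map_gather _ (apply_rightRep u), gather_leftRep_graph,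
          trivial_apply] }

/-- The measure with density `m` relative to a functional invariant under `Γ`. -/
noncomputable def measureOf (J : nearGraph R R φ →ₗ[R] R)
    (hJ : ∀ γ f, J (rightRep R R φ γ f) = J f) : M →ₗ[R] (measureRight R M φ).invariants where
  toFun m := ⟨LinearMap.toSpanSingleton R M m ∘ₗ J, fun γ => by ext f; simp [hJ]⟩
  map_add' m m' := by ext f; simp
  map_smul' r m := by ext f; simp [smul_comm r]

instance epi_evalGraph : Epi (evalGraph hφ τ) := by
  rw [Rep.epi_iff_surjective]
  intro m
  obtain ⟨J, hJ, hJ'⟩ := exists_invariant_retraction R R φ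
  refine ⟨measureOf J hJ m, ?_⟩
  change J (graph R φ 1) • m = m
  rw [hJ', one_smul]

theorem exists_section_evalGraph (hΛ : IsAmenableGroup Λ) (ι : ℚ →+* R) :
    ∃ s : Rep.of τ ⟶ Rep.of (invariantMeasures hφ τ), s ≫ evalGraph hφ τ = 𝟙 _ := by
  obtain ⟨J, hJ, hJ', hJl⟩ := exists_equivariant_retraction hφ hΛ ι (trivial R Λ R)
  refine ⟨Rep.ofHom ⟨measureOf J hJ, fun l => ?_⟩, ?_⟩
  · ext m f
    change J f • τ l m = τ l (J (leftRep hφ (trivial R Λ R) l⁻¹ f) • m)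
    rw [hJl, map_smul, trivial_apply]
  · ext m
    change J (graph R φ 1) • m = m
    rw [hJ', one_smul]

end Cohomology

section Homology

variable {M : Type u} [AddCommGroup M] [Module R M] (τ : Representation R Λ M)

/-- The `Λ`-representation of `Γ`-coinvariants of the `M`-valued functions near the graph. -/
noncomputable abbrev coinvariantFunctions :
    Representation R Λ (rightRep R M φ).Coinvariants :=
  onCoinvariants (leftRep_rightRep hφ τ)

theorem isZero_groupHomology_coinvariantFunctions [Countable Γ] {n : ℕ}
    (h : ∀ N : Rep.{u} R Γ, IsZero (groupHomology N (n + 1))) :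
    IsZero (groupHomology (Rep.of (coinvariantFunctions hφ τ)) (n + 1)) := by
  obtain ⟨D⟩ := exists_leftDecomposition hφ τ
  rw [ModuleCat.isZero_iff_subsingleton, subsingleton_groupHomology_iff_cocycleExact,
    cocycleExact_onCoinvariants_iff]
  refine CocycleExactOn.of_commute (characterDual_comm (leftRep_rightRep hφ τ))
    (D.cocycleExact_linHom _) ((rightDecomposition R M φ).cocycleExact_linHom _) ?_
  rw [← cocycleExact_onCoinvariants_iff fun γ l f => (leftRep_rightRep hφ τ l γ f).symm,
    ← subsingleton_groupHomology_iff_cocycleExact, ← ModuleCat.isZero_iff_subsingleton]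
  exact h _

/-- The classes of the constant functions on the graph of `φ`. -/
noncomputable def graphClass : Rep.of τ ⟶ Rep.of (coinvariantFunctions hφ τ) :=
  Rep.ofHom
    { toLinearMap := Coinvariants.mk _ ∘ₗ graph R φ
      isIntertwining' := fun l => by
        ext m
        change Coinvariants.mk _ (graph R φ (τ l m)) =
          Coinvariants.mk _ (leftRep hφ τ l (graph R φ m))
        rw [← (rightDecomposition R M φ).map_gather (Coinvariants.mk (rightRep R M φ))
          (Coinvariants.mk_self_apply _) (leftRep hφ τ l (graph R φ m)), gather_leftRep_graph] }

instance mono_graphClass : Mono (graphClass hφ τ) := by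
  rw [Rep.mono_iff_injective]
  obtain ⟨J, hJ, hJ'⟩ := exists_invariant_retraction R M φ
  refine Function.LeftInverse.injective
    (g := Coinvariants.lift (rightRep R M φ) J fun γ => LinearMap.ext (hJ γ)) hJ'

theorem exists_retraction_graphClass (hΛ : IsAmenableGroup Λ) (ι : ℚ →+* R) :
    ∃ r : Rep.of (coinvariantFunctions hφ τ) ⟶ Rep.of τ, graphClass hφ τ ≫ r = 𝟙 _ := by
  obtain ⟨J, hJ, hJ', hJl⟩ := exists_equivariant_retraction hφ hΛ ι τ
  refine ⟨Rep.ofHom ⟨Coinvariants.lift (rightRep R M φ) J fun γ => LinearMap.ext (hJ γ),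
    fun l => Coinvariants.hom_ext (LinearMap.ext (hJl l))⟩, ?_⟩
  ext m
  exact hJ' m

end Homology

end nearGraph

end Vanishing

/-! ### Dimension bounds and the theorem -/

section Dimension

variable {R G : Type u} [CommRing R] [Group G]

theorem cohomologicalDimension_le_iff {d : ℕ∞} :
    cohomologicalDimension R G ≤ d ↔
      ∀ n : ℕ, d < n → ∀ M : Rep.{u} R G, IsZero (groupCohomology M n) := by
  rw [cohomologicalDimension, iSup₂_le_iff]
  refine forall_congr' fun n => ?_
  rw [← not_imp_not, not_le]
  simp [ModuleCat.isZero_iff_subsingleton, not_nontrivial_iff_subsingleton]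

theorem homologicalDimension_le_iff {d : ℕ∞} :
    homologicalDimension R G ≤ d ↔
      ∀ n : ℕ, d < n → ∀ M : Rep.{u} R G, IsZero (groupHomology M n) := by
  rw [homologicalDimension, iSup₂_le_iff]
  refine forall_congr' fun n => ?_
  rw [← not_imp_not, not_le]
  simp [ModuleCat.isZero_iff_subsingleton, not_nontrivial_iff_subsingleton]

/-- A property of large natural numbers which descends from `n + 1` to `n` above a bound. -/
theorem forall_lt_of_descending {P : ℕ → Prop} {c d : ℕ∞} (hc : c ≠ ⊤)
    (hP : ∀ n : ℕ, c < n → P n) (step : ∀ n : ℕ, d < n → P (n + 1) → P n) (n : ℕ) (hn : d < n) :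
    P n := by
  lift c to ℕ using hc
  have key (j : ℕ) : ∀ n : ℕ, d < n → c < n + j → P n := by
    induction j with
    | zero => exact fun n _ h => hP n (by exact_mod_cast h)
    | succ j ih =>
      exact fun n hn h => step n hn
        (ih (n + 1) (hn.trans (by exact_mod_cast n.lt_succ_self)) (by omega))
  -- With `j = c + 1` the condition `c < n + j` holds for every `n`, including `0`.
  exact key (c + 1) n hn (by omega)

end Dimension

theorem mainTheorem1 (R Λ Γ : Type u) [CommRing R] [Group Λ] [Group Γ] [Countable Λ] [Countable Γ]
    (h : EmbedsUniformly Λ Γ) :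
    (cohomologicalDimension R Λ ≠ ⊤ →
        cohomologicalDimension R Λ ≤ cohomologicalDimension R Γ) ∧
      (IsAmenableGroup Λ → (∃ ι : ℚ →+* R, Function.Injective ι) →
        cohomologicalDimension R Λ ≤ cohomologicalDimension R Γ) ∧
      (homologicalDimension R Λ ≠ ⊤ →
        homologicalDimension R Λ ≤ homologicalDimension R Γ) ∧
      (IsAmenableGroup Λ → (∃ ι : ℚ →+* R, Function.Injective ι) →
        homologicalDimension R Λ ≤ homologicalDimension R Γ) := by
  obtain ⟨φ, hφ⟩ := h
  have coh (n : ℕ) (hn : cohomologicalDimension R Γ < n) (M : Rep.{u} R Λ) :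
      IsZero (groupCohomology (Rep.of (nearGraph.invariantMeasures hφ M.ρ)) n) := by
    obtain ⟨n, rfl⟩ := Nat.exists_eq_add_one_of_ne_zero fun h0 : n = 0 => by simp [h0] at hn
    exact nearGraph.isZero_groupCohomology_invariantMeasures hφ M.ρ
      (cohomologicalDimension_le_iff.1 le_rfl _ hn)
  have hom (n : ℕ) (hn : homologicalDimension R Γ < n) (M : Rep.{u} R Λ) :
      IsZero (groupHomology (Rep.of (nearGraph.coinvariantFunctions hφ M.ρ)) n) := by
    obtain ⟨n, rfl⟩ := Nat.exists_eq_add_one_of_ne_zero fun h0 : n = 0 => by simp [h0] at hn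
    exact nearGraph.isZero_groupHomology_coinvariantFunctions hφ M.ρ
      (homologicalDimension_le_iff.1 le_rfl _ hn)
  refine ⟨fun hfin => ?_, fun hΛ ⟨ι, _⟩ => ?_, fun hfin => ?_, fun hΛ ⟨ι, _⟩ => ?_⟩
  · exact cohomologicalDimension_le_iff.2 <| forall_lt_of_descending hfin
      (cohomologicalDimension_le_iff.1 le_rfl) fun n hn hK M =>
        isZero_groupCohomology_of_epi (nearGraph.evalGraph hφ M.ρ) (coh n hn M) hK
  · refine cohomologicalDimension_le_iff.2 fun n hn M => ?_
    obtain ⟨s, hs⟩ := nearGraph.exists_section_evalGraph hφ M.ρ hΛ ι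
    exact isZero_groupCohomology_of_retract _ s hs (coh n hn M)
  · exact homologicalDimension_le_iff.2 <| forall_lt_of_descending hfin
      (homologicalDimension_le_iff.1 le_rfl) fun n hn hK M =>
        isZero_groupHomology_of_mono (nearGraph.graphClass hφ M.ρ) (hom n hn M) hK
  · refine homologicalDimension_le_iff.2 fun n hn M => ?_
    obtain ⟨r, hr⟩ := nearGraph.exists_retraction_graphClass hφ M.ρ hΛ ι
    exact isZero_groupHomology_of_retract r _ hr (hom n hn M)
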